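/- Let $G=(V,E)$ be a finite simple undirected graph with edge weights $d_e\ge 0$ ($e\in E$), and let $\mathfrak T$ be a set of unordered pairs of vertices (terminal pairs). For $F\subseteq E$ let $V[F]$ be the set of endpoints of edges of $F$, let $G[F]=(V[F],F)$, and put $d(F)=\sum_{e\in F}d_e$. The width of a connected component of $G[F]$ is the maximum, over all terminal pairs $\{u,\bar u\}\in\mathfrak T$ with both $u$ and $\bar u$ in the component, of the shortest-path distance between $u$ and $\bar u$ in $(G,d)$ (and $0$ if there is no such pair); the total width $w(F)$ is the sum of the widths of the connected components of $G[F]$, and $\phi(F)=d(F)+w(F)$. A set $F\subseteq E$ is feasible if it connects $u$ with $\bar u$ for every $\{u,\bar u\}\in\mathfrak T$. Let $A,F\subseteq E$ be feasible with $V[A]=V[F]$, and suppose that $A$ is a tree. An edge/set swap $(f,S)$ adds to $A$ an edge $f\notin A$ that closes a cycle with $A$ and removes a set $S\subseteq A$ of edges of this cycle, such that $(A\cup\{f\})\setminus S$ is again cycle-free and feasible. Suppose that $A$ is edge/set swap-optimal with respect to $F$ and $\phi$, i.e. $\phi\big((A\cup\{f\})\setminus S\big)\ge\phi(A)$ for every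 edge/set swap $(f,S)$ with $f\in F$. Call an edge $e\in A$ safe if some edge of $F$ crosses between the two connected components of $A\setminus\{e\}$, and unsafe otherwise; let $S_u\subseteq A$ be the set of unsafe edges. Then $$\phi(A)=d(A)+w(A)\;\le\;10.5\cdot d(F)+w(F)+d(S_u)+w(A).$$ In particular, $d(A)\le 10.5\cdot d(F)+w(F)+d(S_u)$. -/

import Mathlib

open scoped NNReal

/-- A Steiner Forest instance on the vertex set `V`: a graph, non-negative edge weights
(only the values of `cost` on edges of the graph are ever used), and a set of unordered
terminal pairs. -/
structure SteinerForestInstance (V : Type*) where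
  graph : SimpleGraph V
  cost : Sym2 V → ℝ≥0
  pairs : Finset (Sym2 V)

namespace SteinerForestInstance

variable {V : Type*} [Fintype V] [DecidableEq V]

/-- The graph on `V` whose edges are the members of the edge set `F`. -/
def edgeGraph (F : Finset (Sym2 V)) : SimpleGraph V :=
  SimpleGraph.fromEdgeSet (F : Set (Sym2 V))

open Classical in
/-- `V[F]`: the vertices that are endpoints of edges of `F`. -/
noncomputable def verts (F : Finset (Sym2 V)) : Finset V :=
  Finset.univ.filter fun v => ∃ e ∈ F, v ∈ e

open Classical in
/-- The vertex set of the connected component of `v` in the graph with edge set `F`. -/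
noncomputable def component (F : Finset (Sym2 V)) (v : V) : Finset V :=
  Finset.univ.filter fun u => (edgeGraph F).Reachable v u

/-- The (vertex sets of the) connected components of `G[F] = (V[F], F)`. -/
noncomputable def components (F : Finset (Sym2 V)) : Finset (Finset V) :=
  (verts F).image (component F)

/-- `F` is a forest: a cycle-free set of edges. -/
def IsForest (F : Finset (Sym2 V)) : Prop :=
  (edgeGraph F).IsAcyclic

/-- `F` is a tree: it is cycle-free and any two vertices of `V[F]` are connected by `F`. -/
def IsTree (F : Finset (Sym2 V)) : Prop :=
  IsForest F ∧ ∀ u ∈ verts F, ∀ v ∈ verts F, (edgeGraph F).Reachable u v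

open Classical in
/-- `δ_F(W)`: the edges of `F` leaving the vertex set `W`. -/
noncomputable def cut (F : Finset (Sym2 V)) (W : Finset V) : Finset (Sym2 V) :=
  F.filter fun e => ∃ u ∈ W, ∃ v ∉ W, e = s(u, v)

/-- `δ_F(W : W') = δ_F(W) ∩ δ_F(W')`, for disjoint `W`, `W'`: the edges of `F` between them. -/
noncomputable def cutBetween (F : Finset (Sym2 V)) (W W' : Finset V) : Finset (Sym2 V) :=
  cut F W ∩ cut F W'

/-- An edge `e = {x, y}` of the tree `A` is safe with respect to `F` if some edge of `F`
crosses between the two connected components of `A \ {e}`, i.e. those of `x` and of `y`. -/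
def IsSafe (A F : Finset (Sym2 V)) (e : Sym2 V) : Prop :=
  ∃ x y : V, e = s(x, y) ∧
    (cutBetween F (component (A.erase e) x) (component (A.erase e) y)).Nonempty

open Classical in
/-- `S_u`: the set of unsafe edges of `A`. -/
noncomputable def unsafeEdges (A F : Finset (Sym2 V)) : Finset (Sym2 V) :=
  A.filter fun e => ¬ IsSafe A F e

variable (I : SteinerForestInstance V)

/-- `F` is a feasible solution: a set of edges of the graph that connects every terminal pair. -/
def Feasible (F : Finset (Sym2 V)) : Prop :=
  (F : Set (Sym2 V)) ⊆ I.graph.edgeSet ∧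
    ∀ u v : V, s(u, v) ∈ I.pairs → (edgeGraph F).Reachable u v

/-- The shortest-path distance of `u` and `v` in the weighted graph (it is only used for terminal
pairs; these are connected in the graph as soon as a feasible solution exists). -/
noncomputable def dist (u v : V) : ℝ≥0 :=
  ⨅ p : I.graph.Walk u v, (p.edges.map I.cost).sum

/-- The width of a connected edge set with vertex set `W`: the maximum distance of a terminal pair
inside `W` (and `0` if there is none). -/
noncomputable def width (W : Finset V) : ℝ≥0 :=
  ((W ×ˢ W).filter fun q => s(q.1, q.2) ∈ I.pairs).sup fun q => I.dist q.1 q.2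

/-- The total width `w(F)`: the sum of the widths of the connected components of `G[F]`. -/
noncomputable def totalWidth (F : Finset (Sym2 V)) : ℝ≥0 :=
  ∑ W ∈ components F, I.width W

/-- `d(F)`: the total length of the edges of `F`. -/
def length (F : Finset (Sym2 V)) : ℝ≥0 :=
  ∑ e ∈ F, I.cost e

/-- The potential `φ(F) = d(F) + w(F)`. -/
noncomputable def potential (F : Finset (Sym2 V)) : ℝ≥0 :=
  I.length F + I.totalWidth F

/-- The edge/set swap `(f, S)` is a legal move from the solution `A`: adding the edge `f` to `A`
creates a cycle, `S` is a set of edges of `A` on that cycle, and adding `f` and removing `S`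
results in a cycle-free feasible solution again. -/
def IsEdgeSetSwap (A : Finset (Sym2 V)) (f : Sym2 V) (S : Finset (Sym2 V)) : Prop :=
  f ∉ A ∧ S ⊆ A ∧
    (∃ (v : V) (c : (edgeGraph (insert f A)).Walk v v),
      c.IsCycle ∧ f ∈ c.edges ∧ ∀ e ∈ S, e ∈ c.edges) ∧
    IsForest (insert f A \ S) ∧ I.Feasible (insert f A \ S)

/-- `A` is edge/set swap-optimal with respect to `F` and `φ`: no edge/set swap that adds an edge
of `F` decreases the potential. -/
def EdgeSetSwapOptimal (A F : Finset (Sym2 V)) : Prop :=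
  ∀ f ∈ F, ∀ S : Finset (Sym2 V), I.IsEdgeSetSwap A f S →
    ¬ I.potential (insert f A \ S) < I.potential A

end SteinerForestInstance

/-! Sort the safe edges of `A` into classes by the nonempty set `D` of edges of `F` that cross them;
call the components of `(A \ S) ∪ F`, where `S` is the class of `D`, its groups. Tree edges that
separate `p` from `q` have nested `p`-sides. Hence, for `f = s(p, q)` in `D` and not in `A`, adding
`f` and removing any nonempty part `S'` of the class gives a forest with the same connectivity as
`(A \ S') ∪ F`, so the swap is legal. Optimality bounds `d(S')` by `d(f)` plus the widths of the new
components other than that of `p`, which `w(A)` pays for (`CutClass.length_le`).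

Two things keep the sum over all classes small. Widths: cutting a class at two vertices uses `f`
three times, but leaves only the groups that avoid both vertices (`CutClass.length_le_of_finset`).
The vertices are a root `r` common to all classes and a vertex of largest rank outside the group of
`r`. Two distinct classes always have a pair of groups covering all vertices (`exists_cover`), and
this makes it possible to charge the remaining groups of all classes injectively to components of
`F`, for a total of at most `w(F)` (`exists_sum_width_le`). Edges: the sides of tree edges away from
`r` are laminar, and a laminar family with distinct nonempty cuts in an edge set `N` has at most `3
* |N|` members (`IsLaminar.card_le`). By Hall's theorem each class gets an `f` in its `D`, each edge
serving at most three classes (`IsTree.exists_assignment`). Altogether `d(F)` is paid `3 * 3 = 9`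
times, which is below `10.5`. -/

set_option linter.unusedSectionVars false

namespace SteinerForestInstance

variable {V : Type*} [Fintype V] [DecidableEq V]

/-! ### Connectivity under edge deletion -/

/-- `x` and `y` are connected by the edge set `F`. -/
abbrev Linked (F : Finset (Sym2 V)) (x y : V) : Prop :=
  (edgeGraph F).Reachable x y

lemma edgeGraph_adj {F : Finset (Sym2 V)} {x y : V} :
    (edgeGraph F).Adj x y ↔ s(x, y) ∈ F ∧ x ≠ y := by
  simp [edgeGraph]

lemma edgeGraph_mono {F F' : Finset (Sym2 V)} (h : F ⊆ F') : edgeGraph F ≤ edgeGraph F' :=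
  SimpleGraph.fromEdgeSet_mono (by exact_mod_cast h)

lemma Linked.mono {F F' : Finset (Sym2 V)} (h : F ⊆ F') {x y : V} (hxy : Linked F x y) :
    Linked F' x y :=
  SimpleGraph.Reachable.mono (edgeGraph_mono h) hxy

lemma linked_of_mem {F : Finset (Sym2 V)} {x y : V} (h : s(x, y) ∈ F) : Linked F x y := by
  by_cases hxy : x = y
  · subst hxy; exact SimpleGraph.Reachable.refl _
  · exact (edgeGraph_adj.2 ⟨h, hxy⟩).reachable

lemma Linked.of_edges {F F' : Finset (Sym2 V)} (h : ∀ x y, s(x, y) ∈ F → Linked F' x y)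
    {x y : V} (hxy : Linked F x y) : Linked F' x y := by
  obtain ⟨p⟩ := hxy
  induction p with
  | nil => exact SimpleGraph.Reachable.refl _
  | cons hadj _ ih => exact (h _ _ (edgeGraph_adj.1 hadj).1).trans ih

lemma Linked.erase_or {F : Finset (Sym2 V)} (a b : V) {x y : V} (hxy : Linked F x y) :
    Linked (F.erase s(a, b)) x y ∨ Linked (F.erase s(a, b)) x a ∨
      Linked (F.erase s(a, b)) x b := by
  obtain ⟨p⟩ := hxy
  induction p with
  | nil => exact Or.inl (SimpleGraph.Reachable.refl _)
  | @cons u v w hadj _ ih =>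
    by_cases huv : s(u, v) = s(a, b)
    · rcases Sym2.eq_iff.1 huv with ⟨rfl, rfl⟩ | ⟨rfl, rfl⟩
      · exact Or.inr (Or.inl (SimpleGraph.Reachable.refl _))
      · exact Or.inr (Or.inr (SimpleGraph.Reachable.refl _))
    · have huv' : Linked (F.erase s(a, b)) u v :=
        linked_of_mem (Finset.mem_erase.2 ⟨huv, (edgeGraph_adj.1 hadj).1⟩)
      exact ih.imp huv'.trans (Or.imp huv'.trans huv'.trans)

lemma Linked.erase_endpoint {F : Finset (Sym2 V)} {a b x : V} (hxa : Linked F x a) :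
    Linked (F.erase s(a, b)) x a ∨ Linked (F.erase s(a, b)) x b := by
  rcases hxa.erase_or a b with h | h | h
  exacts [Or.inl h, Or.inl h, Or.inr h]

lemma Linked.erase_of_not_linked {F : Finset (Sym2 V)} {a b x y : V} (hxy : Linked F x y)
    (hxa : ¬ Linked F x a) : Linked (F.erase s(a, b)) x y := by
  by_cases hab : s(a, b) ∈ F
  · have hsub := Finset.erase_subset s(a, b) F
    rcases hxy.erase_or a b with h | h | h
    · exact h
    · exact absurd (h.mono hsub) hxa
    · exact absurd ((h.mono hsub).trans (linked_of_mem hab).symm) hxa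
  · rwa [Finset.erase_eq_of_notMem hab]

lemma IsForest.mono {F F' : Finset (Sym2 V)} (h : F ⊆ F') (hF : IsForest F') : IsForest F :=
  SimpleGraph.IsAcyclic.anti (edgeGraph_mono h) hF

lemma IsForest.not_linked_erase {A : Finset (Sym2 V)} (hA : IsForest A) {a b : V} (hne : a ≠ b)
    (hab : s(a, b) ∈ A) : ¬ Linked (A.erase s(a, b)) a b := by
  have h := SimpleGraph.isAcyclic_iff_forall_adj_isBridge.1 hA (edgeGraph_adj.2 ⟨hab, hne⟩)
  rw [SimpleGraph.isBridge_iff] at h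
  refine fun hl => h (SimpleGraph.Reachable.mono (fun u v huv => ?_) hl)
  have huv := edgeGraph_adj.1 huv
  rw [Finset.mem_erase] at huv
  rw [SimpleGraph.deleteEdges_adj, edgeGraph_adj]
  exact ⟨⟨huv.1.2, huv.2⟩, huv.1.1⟩

/-- A path in a forest is unique, so it avoids `S` as soon as it avoids each member of `S`
separately. -/
lemma IsForest.linked_sdiff {A : Finset (Sym2 V)} (hA : IsForest A)
    (hd : ∀ e ∈ A, ¬ e.IsDiag) {x y : V} (hxy : Linked A x y) {S : Finset (Sym2 V)}
    (hSA : S ⊆ A) (hS : ∀ e ∈ S, Linked (A.erase e) x y) : Linked (A \ S) x y := by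
  induction S using Finset.induction_on with
  | empty => simpa using hxy
  | @insert e S heS ih =>
    have h1 := ih (fun e he => hSA (Finset.mem_insert_of_mem he))
      fun e he => hS e (Finset.mem_insert_of_mem he)
    have h2 := hS e (Finset.mem_insert_self e S)
    have heA := hSA (Finset.mem_insert_self e S)
    rw [show A \ insert e S = (A \ S).erase e by ext; simp; tauto]
    have hsub : (A \ S).erase e ⊆ A.erase e := Finset.erase_subset_erase e Finset.sdiff_subset
    induction e using Sym2.ind with
    | _ a b =>
    have hbr := hA.not_linked_erase (hd _ heA) heA
    rcases h1.erase_or a b with h | hx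
    · exact h
    rcases Linked.erase_or a b h1.symm with h | hy
    · exact h.symm
    rcases hx with hx | hx <;> rcases hy with hy | hy
    · exact hx.trans hy.symm
    · exact absurd (((hx.mono hsub).symm.trans h2).trans (hy.mono hsub)) hbr
    · exact absurd (((hy.mono hsub).symm.trans h2.symm).trans (hx.mono hsub)) hbr
    · exact hx.trans hy.symm

/-- Deleting an edge of a tree leaves at most two components. -/
lemma linked_erase_of_not {A : Finset (Sym2 V)} {e : Sym2 V} {x y z : V}
    (hA : ∀ v ∈ e, Linked A x v ∧ Linked A y v ∧ Linked A z v)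
    (hxy : ¬ Linked (A.erase e) x y) (hxz : ¬ Linked (A.erase e) x z) :
    Linked (A.erase e) y z := by
  induction e using Sym2.ind with
  | _ a b =>
  obtain ⟨hx, hy, hz⟩ := hA a (Sym2.mem_mk_left a b)
  rcases hx.erase_endpoint (b := b) with hx | hx <;>
    rcases hy.erase_endpoint (b := b) with hy | hy <;>
    rcases hz.erase_endpoint (b := b) with hz | hz <;>
    first
    | exact hy.trans hz.symm
    | exact absurd (hx.trans hy.symm) hxy
    | exact absurd (hx.trans hz.symm) hxz

/-- The cuts of a tree that are defined by two of its edges do not cross. -/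
lemma not_crossing {A : Finset (Sym2 V)} {e e' : Sym2 V} (he' : e' ∈ A) (hne : e ≠ e')
    {x₀₀ x₀₁ x₁₀ x₁₁ : V}
    (hA : ∀ v, v ∈ e ∨ v ∈ e' → Linked A x₀₀ v ∧ Linked A x₁₀ v)
    (h0 : Linked (A.erase e) x₀₀ x₀₁) (h1 : Linked (A.erase e) x₁₀ x₁₁)
    (h : ¬ Linked (A.erase e) x₀₀ x₁₀)
    (h0' : ¬ Linked (A.erase e') x₀₀ x₀₁) (h1' : ¬ Linked (A.erase e') x₁₀ x₁₁) : False := by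
  induction e' using Sym2.ind with
  | _ a b =>
  -- A connection on one side of `e` that breaks without `e'` runs through `e'`, hence reaches `a`
  -- without using `e`. Doing so from both sides of `e` would join them.
  have key : ∀ u w, Linked (A.erase e) u w → ¬ Linked (A.erase s(a, b)) u w →
      Linked (A.erase e) u a := by
    intro u w huw huw'
    by_contra hua
    refine huw' (((huw.erase_of_not_linked (b := b) hua)).mono ?_)
    exact Finset.erase_subset_erase _ (Finset.erase_subset _ _)
  exact h ((key _ _ h0 h0').trans (key _ _ h1 h1').symm)

/-! ### Components, crossing edges and nested tree cuts -/

lemma mem_verts {F : Finset (Sym2 V)} {v : V} : v ∈ verts F ↔ ∃ e ∈ F, v ∈ e := by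
  simp [verts]

lemma mem_component {F : Finset (Sym2 V)} {u v : V} : u ∈ component F v ↔ Linked F v u := by
  simp [component]

lemma component_eq {F : Finset (Sym2 V)} {u v : V} :
    component F u = component F v ↔ Linked F u v := by
  constructor
  · intro h
    rw [← mem_component, h, mem_component]
  · intro h
    ext w
    rw [mem_component, mem_component]
    exact ⟨h.symm.trans, h.trans⟩

lemma mem_components {F : Finset (Sym2 V)} {W : Finset V} :
    W ∈ components F ↔ ∃ v ∈ verts F, component F v = W := by
  simp [components]

/-- The edges of `F` that cross between the two sides of `A \ {e}`. -/
noncomputable def crossing (A F : Finset (Sym2 V)) (e : Sym2 V) : Finset (Sym2 V) :=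
  open Classical in F.filter fun f => ∃ x y, f = s(x, y) ∧ ¬ Linked (A.erase e) x y

lemma mk_mem_crossing {A F : Finset (Sym2 V)} {e : Sym2 V} {x y : V} :
    s(x, y) ∈ crossing A F e ↔ s(x, y) ∈ F ∧ ¬ Linked (A.erase e) x y := by
  simp only [crossing, Finset.mem_filter]
  refine and_congr_right fun _ => ⟨?_, fun h => ⟨x, y, rfl, h⟩⟩
  rintro ⟨u, v, huv, h⟩
  rcases Sym2.eq_iff.1 huv with ⟨rfl, rfl⟩ | ⟨rfl, rfl⟩
  · exact h
  · exact fun h' => h h'.symm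

lemma crossing_nonempty_of_isSafe {A F : Finset (Sym2 V)} {e : Sym2 V} (h : IsSafe A F e) :
    (crossing A F e).Nonempty := by
  obtain ⟨x, y, -, f, hf⟩ := h
  simp only [cutBetween, Finset.mem_inter, cut, Finset.mem_filter] at hf
  obtain ⟨⟨hfF, u, hu, v, hv, rfl⟩, -⟩ := hf
  rw [mem_component] at hu hv
  exact ⟨_, mk_mem_crossing.2 ⟨hfF, fun h => hv (hu.trans h)⟩⟩

lemma mem_verts_of_mem {F : Finset (Sym2 V)} {x y : V} (h : s(x, y) ∈ F) :
    x ∈ verts F ∧ y ∈ verts F :=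
  ⟨mem_verts.2 ⟨_, h, Sym2.mem_mk_left x y⟩, mem_verts.2 ⟨_, h, Sym2.mem_mk_right x y⟩⟩

section Tree

variable {A : Finset (Sym2 V)} {e e' : Sym2 V} {p q x y z : V}

lemma IsTree.linked_of_not (hT : IsTree A) (he : e ∈ A) (hx : x ∈ verts A) (hy : y ∈ verts A)
    (hz : z ∈ verts A) (hxy : ¬ Linked (A.erase e) x y) (hxz : ¬ Linked (A.erase e) x z) :
    Linked (A.erase e) y z := by
  refine linked_erase_of_not (fun v hv => ?_) hxy hxz
  have hv := mem_verts.2 ⟨e, he, hv⟩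
  exact ⟨hT.2 _ hx _ hv, hT.2 _ hy _ hv, hT.2 _ hz _ hv⟩

/-- The cuts defined by the edges of `A` that separate `p` from `q` form a chain. -/
lemma IsTree.chain (hT : IsTree A) (he : e ∈ A) (he' : e' ∈ A) (hp : p ∈ verts A)
    (hq : q ∈ verts A) (hx : x ∈ verts A)
    (hpq : ¬ Linked (A.erase e) p q) (hpq' : ¬ Linked (A.erase e') p q)
    (hpx : ¬ Linked (A.erase e) p x) (hpx' : Linked (A.erase e') p x)
    (hpy : Linked (A.erase e) p y) (hpy' : ¬ Linked (A.erase e') p y) : False := by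
  refine not_crossing (x₀₀ := p) (x₀₁ := y) (x₁₀ := x) (x₁₁ := q) he' ?_ (fun v hv => ?_) hpy
    (hT.linked_of_not he hp hx hq hpx hpq) hpx hpy' (fun h => hpq' (hpx'.trans h))
  · rintro rfl
    exact hpx hpx'
  · have hv : v ∈ verts A := hv.elim (fun h => mem_verts.2 ⟨e, he, h⟩)
      fun h => mem_verts.2 ⟨e', he', h⟩
    exact ⟨hT.2 _ hp _ hv, hT.2 _ hx _ hv⟩

end Tree

/-! ### Swapping one edge for a set of equally crossed tree edges -/

/-- `S` consists of edges of the tree `A` that are all crossed by the same edges of `F`, and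
`s(p, q)` is one of these. -/
structure CutClass (A F : Finset (Sym2 V)) (S : Finset (Sym2 V)) (p q : V) : Prop where
  tree : IsTree A
  verts_eq : verts A = verts F
  not_diag : ∀ e ∈ A, ¬ e.IsDiag
  subset : S ⊆ A
  mem : s(p, q) ∈ F
  not_linked : ∀ e ∈ S, ¬ Linked (A.erase e) p q
  linked_iff : ∀ e ∈ S, ∀ e' ∈ S, ∀ x y, s(x, y) ∈ F →
    (Linked (A.erase e) x y ↔ Linked (A.erase e') x y)

namespace CutClass

variable {A F S S' : Finset (Sym2 V)} {p q x y z : V}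

lemma mono (h : CutClass A F S p q) (hS : S' ⊆ S) : CutClass A F S' p q where
  __ := h
  subset := hS.trans h.subset
  not_linked e he := h.not_linked e (hS he)
  linked_iff e he e' he' := h.linked_iff e (hS he) e' (hS he')

lemma left_mem (h : CutClass A F S p q) : p ∈ verts A :=
  h.verts_eq ▸ (mem_verts_of_mem h.mem).1

lemma right_mem (h : CutClass A F S p q) : q ∈ verts A :=
  h.verts_eq ▸ (mem_verts_of_mem h.mem).2

lemma linked_sdiff (h : CutClass A F S p q) (hx : x ∈ verts A) (hy : y ∈ verts A)
    (hxy : ∀ e ∈ S, Linked (A.erase e) x y) : Linked (A \ S) x y :=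
  h.tree.1.linked_sdiff h.not_diag (h.tree.2 _ hx _ hy) h.subset hxy

lemma linked_right (h : CutClass A F S p q) {e : Sym2 V} (he : e ∈ S) (hx : x ∈ verts A)
    (hpx : ¬ Linked (A.erase e) p x) : Linked (A.erase e) q x :=
  h.tree.linked_of_not (h.subset he) h.left_mem h.right_mem hx (h.not_linked e he) hpx

lemma sdiff_subset_swap : A \ S ⊆ insert s(p, q) A \ S :=
  Finset.sdiff_subset_sdiff (Finset.subset_insert _ _) subset_rfl

lemma linked_swap_ends (h : CutClass A F S p q) (hf : s(p, q) ∉ A) :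
    Linked (insert s(p, q) A \ S) p q :=
  linked_of_mem (by
    rw [Finset.mem_sdiff]
    exact ⟨Finset.mem_insert_self _ _, fun h' => hf (h.subset h')⟩)

/-- If `s(x, y)` crosses no member of `S`, its tree path survives. If it crosses all of them,
nestedness puts one end on the `p`-side of every member and the other on the `q`-side of every
member; these ends stay attached to `p` and `q`, which the new edge joins. -/
lemma linked_swap_of_mem (h : CutClass A F S p q) (hf : s(p, q) ∉ A) (hxy : s(x, y) ∈ F) :
    Linked (insert s(p, q) A \ S) x y := by
  have hx : x ∈ verts A := h.verts_eq ▸ (mem_verts_of_mem hxy).1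
  have hy : y ∈ verts A := h.verts_eq ▸ (mem_verts_of_mem hxy).2
  have hpq := h.linked_swap_ends hf
  have up : ∀ {u v}, Linked (A \ S) u v → Linked (insert s(p, q) A \ S) u v :=
    fun h' => h'.mono sdiff_subset_swap
  by_cases hall : ∀ e ∈ S, Linked (A.erase e) x y
  · exact up (h.linked_sdiff hx hy hall)
  have hall : ∀ e ∈ S, ¬ Linked (A.erase e) x y := by
    push Not at hall
    obtain ⟨e, he, hn⟩ := hall
    exact fun e' he' hl => hn ((h.linked_iff e he e' he' x y hxy).2 hl)
  by_cases h0 : ∀ e ∈ S, Linked (A.erase e) p x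
  · have hqy : Linked (A \ S) q y := h.linked_sdiff h.right_mem hy fun e he =>
      h.linked_right he hy fun hpy => hall e he ((h0 e he).symm.trans hpy)
    exact (up (h.linked_sdiff h.left_mem hx h0)).symm.trans (hpq.trans (up hqy))
  push Not at h0
  obtain ⟨e₁, he₁, hn₁⟩ := h0
  have h1 : ∀ e ∈ S, ¬ Linked (A.erase e) p x := by
    intro e₂ he₂ hl₂
    refine h.tree.chain (h.subset he₁) (h.subset he₂) h.left_mem h.right_mem hx
      (h.not_linked _ he₁) (h.not_linked _ he₂) hn₁ hl₂ (y := y) ?_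
      fun hpy => hall _ he₂ (hl₂.symm.trans hpy)
    exact (h.tree.linked_of_not (h.subset he₁) hx h.left_mem hy (fun h' => hn₁ h'.symm)
      (hall _ he₁))
  have hqx : Linked (A \ S) q x := h.linked_sdiff h.right_mem hx fun e he =>
    h.linked_right he hx (h1 e he)
  have hpy : Linked (A \ S) p y := h.linked_sdiff h.left_mem hy fun e he =>
    h.tree.linked_of_not (h.subset he) hx h.left_mem hy (fun h' => h1 e he h'.symm) (hall e he)
  exact (up hqx).symm.trans (hpq.symm.trans (up hpy))

/-- The right side does not involve `p` and `q`: the components after the swap do not depend on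
which crossing edge is inserted. -/
lemma linked_swap_iff (h : CutClass A F S p q) (hf : s(p, q) ∉ A) :
    Linked (insert s(p, q) A \ S) x y ↔ Linked (A \ S ∪ F) x y := by
  constructor
  · refine Linked.mono fun e he => ?_
    rw [Finset.mem_sdiff, Finset.mem_insert] at he
    rw [Finset.mem_union, Finset.mem_sdiff]
    rcases he with ⟨rfl | heA, heS⟩
    exacts [Or.inr h.mem, Or.inl ⟨heA, heS⟩]
  · refine Linked.of_edges fun u v huv => ?_
    rcases Finset.mem_union.1 huv with huv | huv
    · exact linked_of_mem (sdiff_subset_swap huv)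
    · exact h.linked_swap_of_mem hf huv

lemma linked_of_linked_union (h : CutClass A F S p q) (hxy : Linked (A \ S ∪ F) x y) :
    Linked A x y := by
  refine Linked.of_edges (fun u v huv => ?_) hxy
  rcases Finset.mem_union.1 huv with huv | huv
  · exact linked_of_mem (Finset.sdiff_subset huv)
  · have := mem_verts_of_mem huv
    rw [← h.verts_eq] at this
    exact h.tree.2 _ this.1 _ this.2

lemma verts_union (h : CutClass A F S p q) : verts (A \ S ∪ F) = verts A := by
  ext v
  constructor
  · intro hv
    obtain ⟨e, he, hve⟩ := mem_verts.1 hv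
    rcases Finset.mem_union.1 he with he | he
    · exact mem_verts.2 ⟨e, Finset.sdiff_subset he, hve⟩
    · exact h.verts_eq ▸ mem_verts.2 ⟨e, he, hve⟩
  · intro hv
    rw [h.verts_eq] at hv
    obtain ⟨e, he, hve⟩ := mem_verts.1 hv
    exact mem_verts.2 ⟨e, Finset.mem_union_right _ he, hve⟩

lemma isForest_swap (h : CutClass A F S p q) (hS : S.Nonempty) :
    IsForest (insert s(p, q) A \ S) := by
  obtain ⟨e, he⟩ := hS
  have hn : ¬ (edgeGraph (A \ S)).Reachable p q := fun hl => h.not_linked e he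
    (Linked.mono (fun e' he' => Finset.mem_erase.2 ⟨fun h' =>
      (Finset.mem_sdiff.1 he').2 (h' ▸ he), (Finset.mem_sdiff.1 he').1⟩) hl)
  refine SimpleGraph.IsAcyclic.anti ?_
    ((h.tree.1.mono (Finset.sdiff_subset (t := S))).sup_edge_of_not_reachable hn)
  intro u v huv
  obtain ⟨huv, hne⟩ := edgeGraph_adj.1 huv
  rw [SimpleGraph.sup_adj, edgeGraph_adj, SimpleGraph.edge_adj]
  rw [Finset.mem_sdiff, Finset.mem_insert] at huv
  rcases huv with ⟨huv | huv, hs⟩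
  · right
    rcases Sym2.eq_iff.1 huv with h | h
    · exact ⟨by tauto, hne⟩
    · exact ⟨by tauto, hne⟩
  · exact Or.inl ⟨Finset.mem_sdiff.2 ⟨huv, hs⟩, hne⟩

lemma exists_cycle (h : CutClass A F S p q) (hS : S.Nonempty) (hf : s(p, q) ∉ A) :
    ∃ (v : V) (c : (edgeGraph (insert s(p, q) A)).Walk v v),
      c.IsCycle ∧ s(p, q) ∈ c.edges ∧ ∀ e ∈ S, e ∈ c.edges := by
  obtain ⟨w, hw⟩ := (h.tree.2 q h.right_mem p h.left_mem).exists_isPath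
  have hne : p ≠ q := by
    obtain ⟨e, he⟩ := hS
    rintro rfl
    exact h.not_linked e he (SimpleGraph.Reachable.refl _)
  have hle : edgeGraph A ≤ edgeGraph (insert s(p, q) A) :=
    edgeGraph_mono (Finset.subset_insert _ _)
  have hadj : (edgeGraph (insert s(p, q) A)).Adj p q :=
    edgeGraph_adj.2 ⟨Finset.mem_insert_self _ _, hne⟩
  refine ⟨p, SimpleGraph.Walk.cons hadj (w.mapLe hle), ?_, by simp, fun e he => ?_⟩
  · rw [SimpleGraph.Walk.cons_isCycle_iff]
    refine ⟨(SimpleGraph.Walk.isPath_mapLe hle).2 hw, fun hmem => hf ?_⟩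
    rw [SimpleGraph.Walk.edges_mapLe_eq_edges] at hmem
    exact (edgeGraph_adj.1 (w.edges_subset_edgeSet hmem)).1
  · rw [SimpleGraph.Walk.edges_cons, SimpleGraph.Walk.edges_mapLe_eq_edges]
    refine List.mem_cons_of_mem _ ?_
    by_contra hew
    refine h.not_linked e he (SimpleGraph.Reachable.symm ⟨w.transfer _ fun e' he' => ?_⟩)
    have h1 := w.edges_subset_edgeSet he'
    induction e' using Sym2.ind with
    | _ a b =>
    have h1 := edgeGraph_adj.1 h1
    refine edgeGraph_adj.2 ⟨Finset.mem_erase.2 ⟨?_, h1.1⟩, h1.2⟩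
    rintro rfl
    exact hew he'

end CutClass

/-! ### What optimality says about one swap -/

section Swap

variable (I : SteinerForestInstance V)

lemma width_mono {W W' : Finset V} (h : W ⊆ W') : I.width W ≤ I.width W' :=
  Finset.sup_mono (Finset.filter_subset_filter _ (Finset.product_subset_product h h))

variable {I} {A F S : Finset (Sym2 V)} {p q : V}

lemma CutClass.isEdgeSetSwap (h : CutClass A F S p q) (hA : I.Feasible A) (hF : I.Feasible F)
    (hS : S.Nonempty) (hf : s(p, q) ∉ A) : I.IsEdgeSetSwap A s(p, q) S := by
  refine ⟨hf, h.subset, h.exists_cycle hS hf, h.isForest_swap hS, fun e he => ?_,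
    fun u v huv => ?_⟩
  · have he : e ∈ insert s(p, q) A \ S := he
    rw [Finset.mem_sdiff, Finset.mem_insert] at he
    rcases he.1 with rfl | he
    exacts [hF.1 h.mem, hA.1 he]
  · exact Linked.of_edges (fun _ _ => h.linked_swap_of_mem hf) (hF.2 u v huv)

/-- The new component of `p` lies inside its component in `A`, so `w(A)` pays for it; the others are
components of `(A \ S) ∪ F` without `p`. -/
lemma CutClass.totalWidth_swap_le (h : CutClass A F S p q) (hf : s(p, q) ∉ A) :
    I.totalWidth (insert s(p, q) A \ S) ≤ I.totalWidth A +
      ∑ W ∈ (components (A \ S ∪ F)).filter (p ∉ ·), I.width W := by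
  have hsub : components (insert s(p, q) A \ S) ⊆ components (A \ S ∪ F) := by
    intro W hW
    obtain ⟨v, hv, rfl⟩ := mem_components.1 hW
    refine mem_components.2 ⟨v, ?_, ?_⟩
    · rw [h.verts_union]
      obtain ⟨e, he, hve⟩ := mem_verts.1 hv
      rw [Finset.mem_sdiff, Finset.mem_insert] at he
      rcases he.1 with rfl | he
      · exact h.verts_eq ▸ mem_verts.2 ⟨_, h.mem, hve⟩
      · exact mem_verts.2 ⟨e, he, hve⟩
    · ext u
      rw [mem_component, mem_component, h.linked_swap_iff hf]
  refine (Finset.sum_le_sum_of_subset hsub).trans ?_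
  rw [← Finset.sum_filter_add_sum_filter_not _ (p ∈ ·)]
  refine add_le_add_left ?_ _
  have hsub' : (components (A \ S ∪ F)).filter (p ∈ ·) ⊆ {component (A \ S ∪ F) p} := by
    intro W hW
    rw [Finset.mem_filter] at hW
    obtain ⟨hW, hp⟩ := hW
    obtain ⟨v, hv, rfl⟩ := mem_components.1 hW
    rw [Finset.mem_singleton, component_eq]
    exact mem_component.1 hp
  refine (Finset.sum_le_sum_of_subset hsub').trans ?_
  rw [Finset.sum_singleton]
  refine (I.width_mono (W' := component A p) fun x hx => ?_).trans
    (Finset.single_le_sum (f := I.width) (fun _ _ => zero_le)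
      (mem_components.2 ⟨p, h.left_mem, rfl⟩))
  exact mem_component.2 (h.linked_of_linked_union (mem_component.1 hx))

lemma CutClass.length_le (h : CutClass A F S p q) (hA : I.Feasible A) (hF : I.Feasible F)
    (hOpt : I.EdgeSetSwapOptimal A F) (hS : S.Nonempty) (hf : s(p, q) ∉ A) :
    I.length S ≤ I.cost s(p, q) +
      ∑ W ∈ (components (A \ S ∪ F)).filter (p ∉ ·), I.width W := by
  have h1 := not_lt.1 (hOpt _ h.mem S (h.isEdgeSetSwap hA hF hS hf))
  have h2 := h.totalWidth_swap_le (I := I) hf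
  have h3 : I.length (insert s(p, q) A \ S) + I.length S = I.cost s(p, q) + I.length A := by
    unfold length
    rw [Finset.sum_sdiff (h.subset.trans (Finset.subset_insert _ _)), Finset.sum_insert hf]
  unfold potential at h1
  rw [← NNReal.coe_le_coe] at *
  rw [← NNReal.coe_inj] at h3
  push_cast at *
  linarith

end Swap

/-! ### Splitting a class at finitely many vertices -/

namespace CutClass

variable {A F S S' : Finset (Sym2 V)} {p q x y z : V}

/-- A vertex on the `p`-side of all of `S` hangs on `p`, one on the `q`-side of all of `S` hangs on
`q`. So the vertices outside the group of `p` lie strictly between two members of `S`. -/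
lemma separated (h : CutClass A F S p q) (hx : x ∈ verts A)
    (hpx : ¬ Linked (A \ S ∪ F) p x) :
    (∃ e ∈ S, ¬ Linked (A.erase e) p x) ∧ ∃ e ∈ S, Linked (A.erase e) p x := by
  constructor
  · by_contra! hc
    exact hpx ((h.linked_sdiff h.left_mem hx hc).mono Finset.subset_union_left)
  · by_contra! hc
    have hqx := h.linked_sdiff h.right_mem hx fun e he => h.linked_right he hx (hc e he)
    exact hpx ((linked_of_mem (Finset.mem_union_right _ h.mem)).trans
      (hqx.mono Finset.subset_union_left))

lemma linked_sdiff_of_not_linked (h : CutClass A F S p q) (hf : s(p, q) ∉ A)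
    (hpx : ¬ Linked (A \ S ∪ F) p x) (hxy : Linked (A \ S ∪ F) x y) : Linked (A \ S) x y := by
  rw [← h.linked_swap_iff hf] at hpx hxy
  refine (hxy.erase_of_not_linked (a := p) (b := q) fun h' => hpx h'.symm).mono fun e he => ?_
  rw [Finset.mem_erase, Finset.mem_sdiff, Finset.mem_insert] at he
  exact Finset.mem_sdiff.2 ⟨he.2.1.resolve_left he.1, he.2.2⟩

/-- In the linear order of the nested cuts, `x` lies between `e₁` and `e₂` while `z` does not, and
`z` lies between `e` and `e₁`. So `e` is beyond `z`, and `x` and `z` are on the same side of it. -/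
lemma linked_iff_of_separated (h : CutClass A F S p q) {e₁ e₂ e : Sym2 V} (he₁ : e₁ ∈ S)
    (he₂ : e₂ ∈ S) (he : e ∈ S) (hx : x ∈ verts A)
    (h₁ : ¬ Linked (A.erase e₁) p x) (h₂ : Linked (A.erase e₂) p x)
    (h₁₂ : Linked (A.erase e₁) p z ↔ Linked (A.erase e₂) p z)
    (hez : ¬ (Linked (A.erase e) p z ↔ Linked (A.erase e₁) p z)) :
    Linked (A.erase e) p x ↔ Linked (A.erase e) p z := by
  by_cases hz₁ : Linked (A.erase e₁) p z
  · have hze : ¬ Linked (A.erase e) p z := fun h' => hez (iff_of_true h' hz₁)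
    refine iff_of_false (fun hxe => ?_) hze
    exact h.tree.chain (h.subset he₁) (h.subset he) h.left_mem h.right_mem hx
      (h.not_linked _ he₁) (h.not_linked _ he) h₁ hxe hz₁ hze
  · have hze : Linked (A.erase e) p z := by
      by_contra h'
      exact hez (iff_of_false h' hz₁)
    refine iff_of_true ?_ hze
    by_contra hxe
    exact h.tree.chain (h.subset he) (h.subset he₂) h.left_mem h.right_mem hx
      (h.not_linked _ he) (h.not_linked _ he₂) hxe h₂ hze fun h' => hz₁ (h₁₂.2 h')

/-- `W` lies between two members of `S'`, whereas `Z` shields it from the members of `S` outside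
`S'`; deleting those as well does not split `W`. -/
lemma mem_components_of_subset (h : CutClass A F S p q) (hf : s(p, q) ∉ A) (hS : S' ⊆ S)
    {Z : Finset V} (hZ : Z ⊆ verts A)
    (hconst : ∀ z ∈ Z, ∀ e ∈ S', ∀ e' ∈ S',
      (Linked (A.erase e) p z ↔ Linked (A.erase e') p z))
    (hsep : ∀ e ∈ S, e ∉ S' → ∀ e' ∈ S', ∃ z ∈ Z,
      ¬ (Linked (A.erase e) p z ↔ Linked (A.erase e') p z))
    {W : Finset V} (hW : W ∈ components (A \ S' ∪ F)) (hpW : p ∉ W) :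
    W ∈ components (A \ S ∪ F) ∧ Disjoint Z W := by
  have h' := h.mono hS
  obtain ⟨x, hx, rfl⟩ := mem_components.1 hW
  rw [h'.verts_union] at hx
  rw [mem_component] at hpW
  have hpx : ¬ Linked (A \ S' ∪ F) p x := fun hl => hpW hl.symm
  constructor
  · refine mem_components.2 ⟨x, by rwa [h.verts_union], ?_⟩
    ext y
    rw [mem_component, mem_component]
    refine ⟨Linked.mono (Finset.union_subset_union (Finset.sdiff_subset_sdiff subset_rfl hS)
      subset_rfl), fun hxy => ?_⟩
    have hxy' := h'.linked_sdiff_of_not_linked hf hpx hxy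
    have hpy : ¬ Linked (A \ S' ∪ F) p y := fun hl => hpx (hl.trans hxy.symm)
    have hy : y ∈ verts A := by
      by_cases hne : x = y
      · exact hne ▸ hx
      · obtain ⟨w, hw⟩ := hxy'.symm.exists_isPath
        cases w with
        | nil => exact hx
        | cons hadj _ =>
          exact (mem_verts_of_mem (Finset.sdiff_subset (edgeGraph_adj.1 hadj).1)).1
    have herase : ∀ e ∈ S', Linked (A.erase e) x y := fun e he =>
      hxy'.mono fun e' he' => Finset.mem_erase.2 ⟨fun h' =>
        (Finset.mem_sdiff.1 he').2 (h' ▸ he), (Finset.mem_sdiff.1 he').1⟩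
    refine (h.linked_sdiff hx hy fun e he => ?_).mono Finset.subset_union_left
    by_cases heS' : e ∈ S'
    · exact herase e heS'
    obtain ⟨⟨e₁, he₁, h₁⟩, e₂, he₂, h₂⟩ := h'.separated hx hpx
    obtain ⟨z, hz, hne⟩ := hsep e he heS' e₁ he₁
    have hxz := h.linked_iff_of_separated (hS he₁) (hS he₂) he hx h₁ h₂
      (hconst z hz _ he₁ _ he₂) hne
    have hyz := h.linked_iff_of_separated (hS he₁) (hS he₂) he hy
      (fun hl => h₁ (hl.trans (herase _ he₁).symm)) (h₂.trans (herase _ he₂))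
      (hconst z hz _ he₁ _ he₂) hne
    by_cases hpz : Linked (A.erase e) p z
    · exact (hxz.2 hpz).symm.trans (hyz.2 hpz)
    · exact h.tree.linked_of_not (h.subset he) h.left_mem hx hy (fun hl => hpz (hxz.1 hl))
        fun hl => hpz (hyz.1 hl)
  · refine Finset.disjoint_left.2 fun z hz hzx => ?_
    rw [mem_component] at hzx
    obtain ⟨⟨e₁, he₁, h₁⟩, e₂, he₂, h₂⟩ :=
      h'.separated (hZ hz) fun hl => hpx (hl.trans hzx.symm)
    exact h₁ ((hconst z hz _ he₁ _ he₂).2 h₂)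

lemma linked_comparable (h : CutClass A F S p q) {Z : Finset V} (hZ : Z ⊆ verts A)
    {e e' : Sym2 V} (he : e ∈ S) (he' : e' ∈ S) :
    (∀ z ∈ Z, Linked (A.erase e) p z → Linked (A.erase e') p z) ∨
      ∀ z ∈ Z, Linked (A.erase e') p z → Linked (A.erase e) p z := by
  by_contra! hc
  obtain ⟨⟨z, hz, hze, hze'⟩, z', hz', hze₂, hze₂'⟩ := hc
  exact h.tree.chain (h.subset he') (h.subset he) h.left_mem h.right_mem (hZ hz)
    (h.not_linked _ he') (h.not_linked _ he) hze' hze hze₂ hze₂'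

end CutClass

-- The vertices of `Z` cut the linearly ordered class into at most `|Z| + 1` intervals. Each is
-- swapped separately against the same edge, and a component between two edges of one interval is a
-- group of the whole class that avoids `Z`.
open Classical in
lemma CutClass.length_le_of_finset {I : SteinerForestInstance V} {A F S : Finset (Sym2 V)}
    {p q : V} (h : CutClass A F S p q) (hA : I.Feasible A)
    (hF : I.Feasible F) (hOpt : I.EdgeSetSwapOptimal A F) (hf : s(p, q) ∉ A) {Z : Finset V}
    (hZ : Z ⊆ verts A) :
    I.length S ≤ (Z.card + 1) * I.cost s(p, q) +
      ∑ W ∈ (components (A \ S ∪ F)).filter (Disjoint Z ·), I.width W := by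
  -- The traces of the `p`-sides on `Z` are nested, so their cardinality alone identifies the
  -- interval of `e`.
  set n : Sym2 V → ℕ := fun e => (Z.filter (Linked (A.erase e) p ·)).card with hn
  set P : ℕ → Finset (Sym2 V) := fun k => S.filter (n · = k) with hP
  have hPS : ∀ k, P k ⊆ S := fun k => Finset.filter_subset _ _
  have hlen : I.length S = ∑ k ∈ Finset.range (Z.card + 1), I.length (P k) := by
    unfold length
    rw [Finset.sum_fiberwise_of_maps_to]
    exact fun e _ => Finset.mem_range.2 (Nat.lt_succ_of_le (Finset.card_filter_le _ _))
  have hiff : ∀ e ∈ S, ∀ e' ∈ S, (n e = n e' ↔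
      ∀ z ∈ Z, (Linked (A.erase e) p z ↔ Linked (A.erase e') p z)) := by
    intro e he e' he'
    constructor
    · intro hcard
      have : Z.filter (Linked (A.erase e) p ·) = Z.filter (Linked (A.erase e') p ·) := by
        rcases h.linked_comparable hZ he he' with hc | hc
        · exact Finset.eq_of_subset_of_card_le (fun z hz => by
            rw [Finset.mem_filter] at hz ⊢; exact ⟨hz.1, hc z hz.1 hz.2⟩) hcard.ge
        · exact (Finset.eq_of_subset_of_card_le (fun z hz => by
            rw [Finset.mem_filter] at hz ⊢; exact ⟨hz.1, hc z hz.1 hz.2⟩) hcard.le).symm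
      exact Finset.filter_inj'.1 this
    · intro hall
      exact congrArg Finset.card (Finset.filter_inj'.2 hall)
  have hconst : ∀ k, ∀ z ∈ Z, ∀ e ∈ P k, ∀ e' ∈ P k,
      (Linked (A.erase e) p z ↔ Linked (A.erase e') p z) := by
    intro k z hz e he e' he'
    rw [Finset.mem_filter] at he he'
    exact (hiff e he.1 e' he'.1).1 (he.2.trans he'.2.symm) z hz
  have hsep : ∀ k, ∀ e ∈ S, e ∉ P k → ∀ e' ∈ P k, ∃ z ∈ Z,
      ¬ (Linked (A.erase e) p z ↔ Linked (A.erase e') p z) := by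
    intro k e he hek e' he'
    rw [Finset.mem_filter] at hek he'
    by_contra! hc
    exact hek ⟨he, ((hiff e he e' he'.1).2 hc).trans he'.2⟩
  -- An empty interval has length zero and admits no swap, since the inserted edge would leave its
  -- cycle closed.
  set C : ℕ → Finset (Finset V) := fun k =>
    if (P k).Nonempty then (components (A \ P k ∪ F)).filter (p ∉ ·) else ∅ with hC
  have hCmem : ∀ k W, W ∈ C k → (P k).Nonempty ∧ W ∈ components (A \ P k ∪ F) ∧ p ∉ W := by
    intro k W hW
    simp only [hC] at hW
    split_ifs at hW with hne
    · exact ⟨hne, Finset.mem_filter.1 hW⟩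
    · simp at hW
  have hle : ∀ k, I.length (P k) ≤ I.cost s(p, q) + ∑ W ∈ C k, I.width W := by
    intro k
    by_cases hne : (P k).Nonempty
    · simp only [hC, if_pos hne]
      exact (h.mono (hPS k)).length_le hA hF hOpt hne hf
    · rw [Finset.not_nonempty_iff_eq_empty.1 hne]
      simp [length]
  -- A common component would lie between two edges of interval `k` and between two of interval `l`,
  -- although some vertex of `Z` puts all edges of `l` on one side of it.
  have hdisj : ∀ k l, k ≠ l → Disjoint (C k) (C l) := by
    intro k l hkl
    refine Finset.disjoint_left.2 fun W hWk hWl => hkl ?_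
    obtain ⟨-, hWk, hpW⟩ := hCmem k W hWk
    obtain ⟨-, hWl, -⟩ := hCmem l W hWl
    obtain ⟨x, hx, rfl⟩ := mem_components.1 hWk
    rw [(h.mono (hPS k)).verts_union] at hx
    have hxl : ¬ Linked (A \ P l ∪ F) p x := by
      obtain ⟨y, -, hy⟩ := mem_components.1 hWl
      intro hl
      rw [← hy, mem_component] at hpW
      have hxx : x ∈ component (A \ P l ∪ F) y := by
        rw [hy]; exact mem_component.2 (SimpleGraph.Reachable.refl _)
      exact hpW ((mem_component.1 hxx).trans hl.symm)
    have hxk : ¬ Linked (A \ P k ∪ F) p x := fun hl => hpW (mem_component.2 hl.symm)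
    obtain ⟨⟨e₁, he₁, h₁⟩, e₂, he₂, h₂⟩ := (h.mono (hPS k)).separated hx hxk
    obtain ⟨⟨e₃, he₃, h₃⟩, e₄, he₄, h₄⟩ := (h.mono (hPS l)).separated hx hxl
    by_contra hkl
    have he₃k : e₃ ∉ P k := fun h' => hkl
      ((Finset.mem_filter.1 h').2.symm.trans (Finset.mem_filter.1 he₃).2)
    obtain ⟨z, hz, hne⟩ := hsep k e₃ (hPS l he₃) he₃k e₁ he₁
    have key : ∀ e ∈ P l, (Linked (A.erase e) p x ↔ Linked (A.erase e) p z) := by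
      intro e he
      refine h.linked_iff_of_separated (hPS k he₁) (hPS k he₂) (hPS l he) hx h₁ h₂
        (hconst k z hz _ he₁ _ he₂) ?_
      rwa [hconst l z hz _ he _ he₃]
    exact h₃ ((key _ he₃).2 ((hconst l z hz _ he₃ _ he₄).2 ((key _ he₄).1 h₄)))
  calc I.length S = ∑ k ∈ Finset.range (Z.card + 1), I.length (P k) := hlen
    _ ≤ ∑ k ∈ Finset.range (Z.card + 1), (I.cost s(p, q) + ∑ W ∈ C k, I.width W) :=
        Finset.sum_le_sum fun k _ => hle k
    _ = (Z.card + 1) * I.cost s(p, q) +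
          ∑ W ∈ (Finset.range (Z.card + 1)).biUnion C, I.width W := by
        rw [Finset.sum_add_distrib, Finset.sum_biUnion fun k _ l _ hkl => hdisj k l hkl]
        simp
    _ ≤ _ := by
        refine add_le_add_right (Finset.sum_le_sum_of_subset fun W hW => ?_) _
        obtain ⟨k, -, hW⟩ := Finset.mem_biUnion.1 hW
        obtain ⟨-, hW, hpW⟩ := hCmem k W hW
        exact Finset.mem_filter.2
          (h.mem_components_of_subset hf (hPS k) hZ (hconst k) (hsep k) hW hpW)

/-! ### Counting laminar families with distinct cuts -/

lemma mem_cut {F : Finset (Sym2 V)} {W : Finset V} {x y : V} :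
    s(x, y) ∈ cut F W ↔ s(x, y) ∈ F ∧ ¬ (x ∈ W ↔ y ∈ W) := by
  simp only [cut, Finset.mem_filter]
  refine and_congr_right fun _ => ⟨?_, fun h => ?_⟩
  · rintro ⟨u, hu, v, hv, huv⟩
    rcases Sym2.eq_iff.1 huv with ⟨rfl, rfl⟩ | ⟨rfl, rfl⟩ <;> tauto
  · by_cases hx : x ∈ W
    · exact ⟨x, hx, y, by tauto, rfl⟩
    · exact ⟨y, by tauto, x, hx, Sym2.eq_swap⟩

/-- The number of incidences between the edges of `F` and the vertices of `W`. -/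
def incidences (F : Finset (Sym2 V)) (W : Finset V) : ℕ :=
  ∑ v ∈ W, (F.filter (v ∈ ·)).card

lemma incidences_mono (F : Finset (Sym2 V)) {W W' : Finset V} (h : W ⊆ W') :
    incidences F W ≤ incidences F W' :=
  Finset.sum_le_sum_of_subset h

lemma incidences_univ_le (F : Finset (Sym2 V)) : incidences F Finset.univ ≤ 2 * F.card := by
  have h : incidences F Finset.univ = ∑ e ∈ F, (Finset.univ.filter (· ∈ e)).card :=
    Finset.sum_card_bipartiteAbove_eq_sum_card_bipartiteBelow (fun (v : V) (e : Sym2 V) => v ∈ e)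
  rw [h, mul_comm, ← smul_eq_mul]
  refine Finset.sum_le_card_nsmul _ _ _ fun e _ => ?_
  induction e using Sym2.ind with
  | _ a b =>
  refine (Finset.card_le_card (t := {a, b}) fun v hv => ?_).trans Finset.card_le_two
  simpa using hv

lemma card_cut_le_incidences (F : Finset (Sym2 V)) (W : Finset V) :
    (cut F W).card ≤ incidences F W := by
  refine (Finset.card_le_card (t := W.biUnion fun v => F.filter (v ∈ ·)) fun e he => ?_).trans
    Finset.card_biUnion_le
  simp only [cut, Finset.mem_filter] at he
  obtain ⟨heF, u, hu, v, -, rfl⟩ := he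
  exact Finset.mem_biUnion.2 ⟨u, hu, Finset.mem_filter.2 ⟨heF, Sym2.mem_mk_left u v⟩⟩

lemma incidences_lt_of_cut_ne {F : Finset (Sym2 V)} {W W' : Finset V} (h : W ⊆ W')
    (hne : cut F W ≠ cut F W') : incidences F W < incidences F W' := by
  by_contra! hle
  have hsum : incidences F (W' \ W) + incidences F W = incidences F W' :=
    Finset.sum_sdiff h
  have hzero : incidences F (W' \ W) = 0 := by omega
  rw [incidences, Finset.sum_eq_zero_iff] at hzero
  have key : ∀ e ∈ F, ∀ v ∈ e, v ∈ W' → v ∈ W := by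
    intro e he v hv hv'
    by_contra hvW
    have := hzero v (Finset.mem_sdiff.2 ⟨hv', hvW⟩)
    rw [Finset.card_eq_zero, Finset.filter_eq_empty_iff] at this
    exact this he hv
  apply hne
  ext e
  induction e using Sym2.ind with
  | _ a b =>
  rw [mem_cut, mem_cut]
  refine and_congr_right fun he => not_congr ?_
  have ha : a ∈ W' ↔ a ∈ W := ⟨key _ he a (Sym2.mem_mk_left a b), fun h' => h h'⟩
  have hb : b ∈ W' ↔ b ∈ W := ⟨key _ he b (Sym2.mem_mk_right a b), fun h' => h h'⟩
  rw [ha, hb]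

/-- A family of sets any two of which are disjoint or nested. -/
def IsLaminar (X : Finset (Finset V)) : Prop :=
  ∀ C ∈ X, ∀ D ∈ X, Disjoint C D ∨ C ⊆ D ∨ D ⊆ C

lemma IsLaminar.exists_maximal {X : Finset (Finset V)} (hX : IsLaminar X) :
    ∃ M ⊆ X, (M : Set (Finset V)).PairwiseDisjoint id ∧ ∀ C ∈ X, ∃ D ∈ M, C ⊆ D := by
  classical
  refine ⟨X.filter fun C => ∀ D ∈ X, C ⊆ D → D ⊆ C, Finset.filter_subset _ _, ?_, ?_⟩
  · intro C hC D hD hne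
    simp only [Finset.coe_filter, Set.mem_ofPred_eq] at hC hD
    rcases hX C hC.1 D hD.1 with h | h | h
    · exact h
    · exact absurd (h.antisymm (hC.2 D hD.1 h)) hne
    · exact absurd ((hD.2 C hC.1 h).antisymm h) hne
  · intro C hC
    obtain ⟨D, hCD, hD⟩ := X.exists_le_maximal hC
    exact ⟨D, Finset.mem_filter.2 ⟨hD.1, fun E hE h => hD.2 hE h⟩, hCD⟩

/-- The number of members of `X` inside `C` that are crossed by at least two edges of `F`. -/
noncomputable def manyCrossed (F : Finset (Sym2 V)) (X : Finset (Finset V)) (C : Finset V) : ℕ :=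
  (X.filter fun D => D ⊆ C ∧ 2 ≤ (cut F D).card).card

lemma sum_manyCrossed_add_card_le {F : Finset (Sym2 V)} {X M : Finset (Finset V)} {W : Finset V}
    (hM : (M : Set (Finset V)).PairwiseDisjoint id) (hW : ∀ D ∈ M, D ⊆ W)
    (h : ∀ D ∈ M, manyCrossed F X D + 1 ≤ incidences F D) :
    ∑ D ∈ M, manyCrossed F X D + M.card ≤ incidences F W := by
  calc ∑ D ∈ M, manyCrossed F X D + M.card = ∑ D ∈ M, (manyCrossed F X D + 1) := by
        rw [Finset.sum_add_distrib]; simp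
    _ ≤ ∑ D ∈ M, incidences F D := Finset.sum_le_sum h
    _ = incidences F (M.biUnion id) := (Finset.sum_biUnion hM).symm
    _ ≤ incidences F W := incidences_mono F (Finset.biUnion_subset.2 hW)

/-- Induction over the maximal members properly inside `C`. The spare incidence of each of them must
pay for `C` itself and for a new spare one. -/
lemma manyCrossed_add_one_le {F : Finset (Sym2 V)} {X : Finset (Finset V)} (hX : IsLaminar X)
    (hne : ∀ C ∈ X, (cut F C).Nonempty) (hinj : Set.InjOn (cut F) X) {C : Finset V} (hC : C ∈ X) :
    manyCrossed F X C + 1 ≤ incidences F C := by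
  classical
  induction C using Finset.strongInduction with
  | _ C ih =>
  obtain ⟨M, hMsub, hMdisj, hMmax⟩ := IsLaminar.exists_maximal (X := X.filter (· ⊂ C))
    fun D hD E hE => hX D (Finset.mem_filter.1 hD).1 E (Finset.mem_filter.1 hE).1
  have hM : ∀ D ∈ M, D ∈ X ∧ D ⊂ C := fun D hD => Finset.mem_filter.1 (hMsub hD)
  have hsum := sum_manyCrossed_add_card_le hMdisj (fun D hD => (hM D hD).2.subset)
    fun D hD => ih D (hM D hD).2 (hM D hD).1
  have hcut := card_cut_le_incidences F C
  have hpos := Finset.card_pos.2 (hne C hC)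
  have hbelow : X.filter (fun D => D ⊆ C ∧ 2 ≤ (cut F D).card) ⊆
      ({C} : Finset (Finset V)).filter (fun D => 2 ≤ (cut F D).card) ∪
        M.biUnion fun E => X.filter fun D => D ⊆ E ∧ 2 ≤ (cut F D).card := by
    intro D hD
    obtain ⟨hDX, hDC, hD2⟩ := Finset.mem_filter.1 hD
    rw [Finset.mem_union]
    rcases hDC.eq_or_ssubset with rfl | hss
    · exact Or.inl (Finset.mem_filter.2 ⟨Finset.mem_singleton_self D, hD2⟩)
    · obtain ⟨E, hE, hDE⟩ := hMmax D (Finset.mem_filter.2 ⟨hDX, hss⟩)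
      exact Or.inr (Finset.mem_biUnion.2 ⟨E, hE, Finset.mem_filter.2 ⟨hDX, hDE, hD2⟩⟩)
  have hle : manyCrossed F X C ≤
      (({C} : Finset (Finset V)).filter (fun D => 2 ≤ (cut F D).card)).card +
        ∑ D ∈ M, manyCrossed F X D :=
    (Finset.card_le_card hbelow).trans ((Finset.card_union_le _ _).trans
      (add_le_add_right Finset.card_biUnion_le _))
  have hone : (({C} : Finset (Finset V)).filter (fun D => 2 ≤ (cut F D).card)).card ≤ 1 :=
    (Finset.card_filter_le _ _).trans (Finset.card_singleton C).le
  -- Two or more children have enough spare incidences. Without children, the cut of `C` provides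
  -- them; with a single child, its cut differs from that of `C`, which yields an extra incidence.
  rcases Nat.lt_or_ge M.card 2 with hlt | hge
  · rcases (by omega : M.card = 0 ∨ M.card = 1) with h0 | h1
    · rw [Finset.card_eq_zero] at h0
      subst h0
      simp only [Finset.sum_empty, Finset.filter_singleton] at hle
      split_ifs at hle with h2
      · simp at hle; omega
      · simp at hle; omega
    · obtain ⟨D, rfl⟩ := Finset.card_eq_one.1 h1
      obtain ⟨hDX, hDC⟩ := hM D (Finset.mem_singleton_self D)
      have hD := ih D hDC hDX
      have hlt' := incidences_lt_of_cut_ne (F := F) hDC.subset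
        fun h => hDC.ne (hinj hDX hC h)
      simp only [Finset.sum_singleton] at hle
      omega
  · omega

/-- Members crossed at least twice are bounded by the `2 * |F|` incidences, members crossed once by
`|F|`, as their cuts are distinct singletons. -/
lemma IsLaminar.card_le {F : Finset (Sym2 V)} {X : Finset (Finset V)} (hX : IsLaminar X)
    (hne : ∀ C ∈ X, (cut F C).Nonempty) (hinj : Set.InjOn (cut F) X) :
    X.card ≤ 3 * F.card := by
  classical
  obtain ⟨M, hMsub, hMdisj, hMmax⟩ := hX.exists_maximal
  have hsum := sum_manyCrossed_add_card_le hMdisj (fun D _ => Finset.subset_univ D)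
    fun D hD => manyCrossed_add_one_le hX hne hinj (hMsub hD)
  have huniv := incidences_univ_le F
  have hmany : (X.filter fun D => 2 ≤ (cut F D).card).card ≤ ∑ D ∈ M, manyCrossed F X D := by
    refine (Finset.card_le_card fun D hD => ?_).trans Finset.card_biUnion_le
    obtain ⟨hDX, hD2⟩ := Finset.mem_filter.1 hD
    obtain ⟨E, hE, hDE⟩ := hMmax D hDX
    exact Finset.mem_biUnion.2 ⟨E, hE, Finset.mem_filter.2 ⟨hDX, hDE, hD2⟩⟩
  have hfew : (X.filter fun D => ¬ 2 ≤ (cut F D).card).card ≤ F.card := by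
    have himg : (X.filter fun D => ¬ 2 ≤ (cut F D).card).image (cut F) ⊆
        F.image fun e => {e} := by
      intro T hT
      obtain ⟨D, hD, rfl⟩ := Finset.mem_image.1 hT
      obtain ⟨hDX, hD2⟩ := Finset.mem_filter.1 hD
      have hpos := Finset.card_pos.2 (hne D hDX)
      obtain ⟨e, he⟩ := Finset.card_eq_one.1 (by omega : (cut F D).card = 1)
      refine Finset.mem_image.2 ⟨e, ?_, he.symm⟩
      have hmem : e ∈ cut F D := he ▸ Finset.mem_singleton_self e
      exact (Finset.mem_filter.1 hmem).1
    rw [← Finset.card_image_of_injOn (hinj.mono (Finset.coe_subset.2 (Finset.filter_subset _ _)))]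
    exact (Finset.card_le_card himg).trans Finset.card_image_le
  have hsplit := Finset.card_filter_add_card_filter_not (s := X) fun D => 2 ≤ (cut F D).card
  omega

/-! ### Far sides of tree edges and the assignment by Hall's theorem -/

lemma Linked.mem_verts {F : Finset (Sym2 V)} {x y : V} (h : Linked F x y) (hx : x ∈ verts F) :
    y ∈ verts F := by
  obtain ⟨w⟩ := h.symm
  cases w with
  | nil => exact hx
  | cons hadj _ => exact (mem_verts_of_mem (edgeGraph_adj.1 hadj).1).1

lemma IsTree.not_linked_iff {A : Finset (Sym2 V)} (hT : IsTree A) {e : Sym2 V} (he : e ∈ A)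
    {r x y : V} (hr : r ∈ verts A) (hx : x ∈ verts A) (hy : y ∈ verts A) :
    ¬ Linked (A.erase e) x y ↔
      ¬ (¬ Linked (A.erase e) r x ↔ ¬ Linked (A.erase e) r y) := by
  constructor
  · intro h hiff
    by_cases hrx : Linked (A.erase e) r x
    · exact h (hrx.symm.trans (not_not.1 fun h' => hiff.2 h' hrx))
    · exact h (hT.linked_of_not he hr hx hy hrx (hiff.1 hrx))
  · exact fun h hxy => h (not_congr ⟨fun h' => h'.trans hxy, fun h' => h'.trans hxy.symm⟩)

open Classical in
/-- The side of `A \ {e}` that does not contain `r`. -/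
noncomputable def farSide (A : Finset (Sym2 V)) (r : V) (e : Sym2 V) : Finset V :=
  (verts A).filter fun x => ¬ Linked (A.erase e) r x

lemma IsTree.farSide_laminar {A : Finset (Sym2 V)} (hT : IsTree A) {r : V} (hr : r ∈ verts A)
    {e e' : Sym2 V} (he : e ∈ A) (he' : e' ∈ A) :
    Disjoint (farSide A r e) (farSide A r e') ∨ farSide A r e ⊆ farSide A r e' ∨
      farSide A r e' ⊆ farSide A r e := by
  by_cases hne : e = e'
  · exact Or.inr (Or.inl (hne ▸ subset_rfl))
  by_contra! hc
  obtain ⟨h1, h2, h3⟩ := hc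
  obtain ⟨x, hx, hx'⟩ := Finset.not_disjoint_iff.1 h1
  obtain ⟨y, hy, hy'⟩ := Finset.not_subset.1 h2
  obtain ⟨z, hz, hz'⟩ := Finset.not_subset.1 h3
  simp only [farSide, Finset.mem_filter, not_and, not_not] at hx hx' hy hy' hz hz'
  refine not_crossing (x₀₀ := r) (x₀₁ := z) (x₁₀ := y) (x₁₁ := x) he' hne (fun v hv => ?_)
    (hz' hz.1) (hT.linked_of_not he hr hy.1 hx.1 hy.2 hx.2) hy.2 hz.2
    fun hyx => hx'.2 ((hy' hy.1).trans hyx)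
  have hv : v ∈ verts A := hv.elim (fun h => SteinerForestInstance.mem_verts.2 ⟨e, he, h⟩)
    fun h => SteinerForestInstance.mem_verts.2 ⟨e', he', h⟩
  exact ⟨hT.2 _ hr _ hv, hT.2 _ hy.1 _ hv⟩

lemma IsTree.cut_farSide {A F N : Finset (Sym2 V)} (hT : IsTree A) (hAF : verts A = verts F)
    {r : V} (hr : r ∈ verts A) {e : Sym2 V} (he : e ∈ A) (hN : crossing A F e ⊆ N)
    (hNF : N ⊆ F) : cut N (farSide A r e) = crossing A F e := by
  ext f
  induction f using Sym2.ind with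
  | _ x y =>
  have key : s(x, y) ∈ F → (¬ (x ∈ farSide A r e ↔ y ∈ farSide A r e) ↔
      ¬ Linked (A.erase e) x y) := fun hf => by
    have hxy := mem_verts_of_mem hf
    rw [← hAF] at hxy
    simp only [farSide, Finset.mem_filter, hxy.1, hxy.2, true_and]
    exact (hT.not_linked_iff he hr hxy.1 hxy.2).symm
  rw [mem_cut]
  constructor
  · rintro ⟨hf, h⟩
    exact mk_mem_crossing.2 ⟨hNF hf, (key (hNF hf)).1 h⟩
  · intro hf
    have hf' := mk_mem_crossing.1 hf
    exact ⟨hN hf, (key hf'.1).2 hf'.2⟩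

/-- The nonempty sets of edges of `F` that cross an edge of `A`. -/
noncomputable def crossingSets (A F : Finset (Sym2 V)) : Finset (Finset (Sym2 V)) :=
  (A.image (crossing A F)).erase ∅

/-- The edges of `A` that are crossed exactly by the edges in `D`. -/
noncomputable def edgeClass (A F D : Finset (Sym2 V)) : Finset (Sym2 V) :=
  A.filter fun e => crossing A F e = D

lemma mem_edgeClass {A F D : Finset (Sym2 V)} {e : Sym2 V} :
    e ∈ edgeClass A F D ↔ e ∈ A ∧ crossing A F e = D :=
  Finset.mem_filter

lemma mem_crossingSets {A F D : Finset (Sym2 V)} :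
    D ∈ crossingSets A F ↔ D.Nonempty ∧ ∃ e ∈ A, crossing A F e = D := by
  simp [crossingSets, Finset.nonempty_iff_ne_empty]

lemma subset_of_mem_crossingSets {A F D : Finset (Sym2 V)} (hD : D ∈ crossingSets A F) :
    D ⊆ F := by
  obtain ⟨-, e, -, rfl⟩ := mem_crossingSets.1 hD
  classical exact Finset.filter_subset _ _

/-- Each crossing set can be assigned one of its edges so that no edge is used more than
three times. -/
lemma IsTree.exists_assignment {A F : Finset (Sym2 V)} (hT : IsTree A) (hAF : verts A = verts F)
    {r : V} (hr : r ∈ verts A) :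
    ∃ g : crossingSets A F → Sym2 V × Fin 3, Function.Injective g ∧ ∀ D, (g D).1 ∈ D.1 := by
  classical
  have hrep : ∀ D : crossingSets A F, ∃ e ∈ A, crossing A F e = D.1 := fun D =>
    (mem_crossingSets.1 D.2).2
  choose rep hrepA hrep using hrep
  have hall : ∀ s : Finset (crossingSets A F),
      s.card ≤ (s.biUnion fun D => D.1 ×ˢ (Finset.univ : Finset (Fin 3))).card := by
    intro s
    -- Hall's condition counts only edges in the chosen crossing sets. Passing from `F` to their
    -- union `N` leaves the relevant cuts unchanged, so the laminar bound can be applied to `N`.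
    set N : Finset (Sym2 V) := s.biUnion fun D => D.1 with hN
    have hNF : N ⊆ F := Finset.biUnion_subset.2 fun D _ => subset_of_mem_crossingSets D.2
    have hcut : ∀ D ∈ s, cut N (farSide A r (rep D)) = D.1 := fun D hD =>
      (hT.cut_farSide hAF hr (hrepA D)
        ((hrep D).symm ▸ Finset.subset_biUnion_of_mem (fun D => D.1) hD) hNF).trans (hrep D)
    have hprod : (s.biUnion fun D => D.1 ×ˢ (Finset.univ : Finset (Fin 3))) =
        N ×ˢ (Finset.univ : Finset (Fin 3)) := by
      ext ⟨a, i⟩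
      simp [hN]
    rw [hprod, Finset.card_product, Finset.card_univ, Fintype.card_fin, mul_comm]
    have hcard : (s.image fun D => farSide A r (rep D)).card = s.card := by
      refine Finset.card_image_of_injOn fun D hD D' hD' h => Subtype.ext ?_
      rw [← hcut D hD, ← hcut D' hD']
      exact congrArg (cut N) h
    rw [← hcard]
    refine IsLaminar.card_le ?_ ?_ ?_
    · intro C hC C' hC'
      obtain ⟨D, -, rfl⟩ := Finset.mem_image.1 hC
      obtain ⟨D', -, rfl⟩ := Finset.mem_image.1 hC'
      exact hT.farSide_laminar hr (hrepA D) (hrepA D')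
    · intro C hC
      obtain ⟨D, hD, rfl⟩ := Finset.mem_image.1 hC
      rw [hcut D hD]
      exact (mem_crossingSets.1 D.2).1
    · intro C hC C' hC' h
      obtain ⟨D, hD, rfl⟩ := Finset.mem_image.1 hC
      obtain ⟨D', hD', rfl⟩ := Finset.mem_image.1 hC'
      rw [hcut D hD, hcut D' hD'] at h
      rw [Subtype.ext h]
  obtain ⟨g, hg, hgD⟩ := (Finset.all_card_le_biUnion_card_iff_exists_injective
    fun D : crossingSets A F => D.1 ×ˢ (Finset.univ : Finset (Fin 3))).1 hall
  exact ⟨g, hg, fun D => (Finset.mem_product.1 (hgD D)).1⟩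

lemma cutClass_edgeClass {A F D : Finset (Sym2 V)} (hT : IsTree A) (hAF : verts A = verts F)
    (hd : ∀ e ∈ A, ¬ e.IsDiag) (hD : D ∈ crossingSets A F) {p q : V} (hpq : s(p, q) ∈ D) :
    CutClass A F (edgeClass A F D) p q where
  tree := hT
  verts_eq := hAF
  not_diag := hd
  subset := Finset.filter_subset _ _
  mem := subset_of_mem_crossingSets hD hpq
  not_linked e he := (mk_mem_crossing.1 ((mem_edgeClass.1 he).2.symm ▸ hpq)).2
  linked_iff e he e' he' x y hxy := by
    have h : s(x, y) ∈ crossing A F e ↔ s(x, y) ∈ crossing A F e' := by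
      rw [(mem_edgeClass.1 he).2, (mem_edgeClass.1 he').2]
    rw [mk_mem_crossing, mk_mem_crossing] at h
    exact not_iff_not.1 (by simpa [hxy] using h)

/-! ### Covering the vertices by groups of two classes -/

/-- A vertex outside the `S`-group of `p'` is cut off from `p'` by some `e` in `S`. As `e` does not
separate `p'` from `q'` but all of `S'` does, no edge of `S'` splits the side of `e` away from `p'`.
Each such side contains `p` or `q`, which `F` joins, so all these sides lie in one `S'`-group. -/
lemma CutClass.linked_of_not_linked {A F S S' : Finset (Sym2 V)} {p q p' q' x y : V}
    (h : CutClass A F S p q) (h' : CutClass A F S' p' q')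
    (hS : ∀ e ∈ S, Linked (A.erase e) p' q') (hx : x ∈ verts A) (hy : y ∈ verts A)
    (hpx : ¬ Linked (A \ S ∪ F) p' x) (hpy : ¬ Linked (A \ S ∪ F) p' y) :
    Linked (A \ S' ∪ F) x y := by
  have far : ∀ u ∈ verts A, ¬ Linked (A \ S ∪ F) p' u →
      ∃ e ∈ S, ¬ Linked (A.erase e) p' u := by
    intro u hu hn
    by_contra! hc
    exact hn ((h.linked_sdiff h'.left_mem hu hc).mono Finset.subset_union_left)
  have same : ∀ e ∈ S, ∀ u ∈ verts A, ∀ v ∈ verts A, ¬ Linked (A.erase e) p' u →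
      ¬ Linked (A.erase e) p' v → Linked (A \ S' ∪ F) u v := by
    intro e he u hu v hv hpu hpv
    refine (h'.linked_sdiff hu hv fun e' he' => ?_).mono Finset.subset_union_left
    by_contra huv
    refine not_crossing (x₀₀ := p') (x₀₁ := q') (x₁₀ := u) (x₁₁ := v) (h'.subset he') ?_
      (fun w hw => ?_) (hS e he)
      (h.tree.linked_of_not (h.subset he) h'.left_mem hu hv hpu hpv) hpu (h'.not_linked e' he') huv
    · rintro rfl
      exact h'.not_linked e he' (hS e he)
    · have hw : w ∈ verts A :=
        hw.elim (fun hw => SteinerForestInstance.mem_verts.2 ⟨e, h.subset he, hw⟩)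
          fun hw => SteinerForestInstance.mem_verts.2 ⟨e', h'.subset he', hw⟩
      exact ⟨h.tree.2 _ h'.left_mem _ hw, h.tree.2 _ hu _ hw⟩
  have hpq : Linked (A \ S' ∪ F) p q := linked_of_mem (Finset.mem_union_right _ h.mem)
  have to_p : ∀ u ∈ verts A, ¬ Linked (A \ S ∪ F) p' u → Linked (A \ S' ∪ F) p u := by
    intro u hu hn
    obtain ⟨e, he, hne⟩ := far u hu hn
    by_cases hp : Linked (A.erase e) p' p
    · refine hpq.trans (same e he q h.right_mem u hu (fun hq => ?_) hne)
      exact h.not_linked e he (hp.symm.trans hq)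
    · exact same e he p h.left_mem u hu hp hne
  exact (to_p x hx hpx).symm.trans (to_p y hy hpy)

/-- Two different edge classes have complementary groups. -/
lemma exists_cover {A F D D' : Finset (Sym2 V)} (hT : IsTree A) (hAF : verts A = verts F)
    (hd : ∀ e ∈ A, ¬ e.IsDiag) (hD : D ∈ crossingSets A F) (hD' : D' ∈ crossingSets A F)
    (hne : D ≠ D') :
    ∃ g g', ∀ x ∈ verts A, Linked (A \ edgeClass A F D ∪ F) g x ∨
      Linked (A \ edgeClass A F D' ∪ F) g' x := by
  have aux : ∀ D ∈ crossingSets A F, ∀ D' ∈ crossingSets A F, ¬ D' ⊆ D →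
      ∃ g g', ∀ x ∈ verts A, Linked (A \ edgeClass A F D ∪ F) g x ∨
        Linked (A \ edgeClass A F D' ∪ F) g' x := by
    intro D hD D' hD' hsub
    obtain ⟨f, hf', hf⟩ := Finset.not_subset.1 hsub
    obtain ⟨f₀, hf₀⟩ := (mem_crossingSets.1 hD).1
    induction f using Sym2.ind with
    | _ p' q' =>
    induction f₀ using Sym2.ind with
    | _ p q =>
    have h := cutClass_edgeClass hT hAF hd hD hf₀
    have h' := cutClass_edgeClass hT hAF hd hD' hf'
    have hS : ∀ e ∈ edgeClass A F D, Linked (A.erase e) p' q' := by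
      intro e he
      by_contra hl
      exact hf ((mem_edgeClass.1 he).2 ▸ mk_mem_crossing.2 ⟨h'.mem, hl⟩)
    by_cases hx : ∃ x ∈ verts A, ¬ Linked (A \ edgeClass A F D ∪ F) p' x
    · obtain ⟨x, hx, hpx⟩ := hx
      exact ⟨p', x, fun y hy => or_iff_not_imp_left.2 fun hpy =>
        h.linked_of_not_linked h' hS hx hy hpx hpy⟩
    · push Not at hx
      exact ⟨p', p', fun y hy => Or.inl (hx y hy)⟩
  by_cases hsub : D' ⊆ D
  · obtain ⟨g, g', h⟩ := aux D' hD' D hD fun hsub' => hne (hsub'.antisymm hsub)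
    exact ⟨g', g, fun x hx => (h x hx).symm⟩
  · exact aux D hD D' hD' hsub

/-! ### Charging groups to components of `F` -/

section Charging

variable (I : SteinerForestInstance V) (F : Finset (Sym2 V))

/-- A vertex ranking that separates the components of `F` and refines the order by width. -/
noncomputable def widthRank (v : V) : ℝ≥0 ×ₗ Fin (Fintype.card (Finset V)) :=
  toLex (I.width (component F v), Fintype.equivFin _ (component F v))

variable {I F}

lemma linked_of_widthRank_eq {x y : V} (h : I.widthRank F x = I.widthRank F y) :
    Linked F x y := by
  have h2 := congrArg (fun z => (ofLex z).2) h
  exact component_eq.1 ((Fintype.equivFin (Finset V)).injective h2)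

lemma widthRank_eq_of_linked {x y : V} (h : Linked F x y) :
    I.widthRank F x = I.widthRank F y := by
  rw [widthRank, widthRank, component_eq.2 h]

lemma width_le_of_widthRank_le {x y : V} (h : I.widthRank F x ≤ I.widthRank F y) :
    I.width (component F x) ≤ I.width (component F y) := by
  rcases Prod.Lex.toLex_le_toLex.1 h with h | h
  exacts [h.le, h.1.le]

/-- By feasibility each terminal pair in `W` lies in one component of `F`, whose rank is at most
that of `m`. -/
lemma width_le_of_maximal (hF : I.Feasible F) {W : Finset V} {m : V}
    (hm : ∀ x ∈ W, I.widthRank F x ≤ I.widthRank F m) :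
    I.width W ≤ I.width (component F m) := by
  refine Finset.sup_le fun ⟨u, v⟩ huv => ?_
  simp only [Finset.mem_filter, Finset.mem_product] at huv
  refine le_trans ?_ (width_le_of_widthRank_le (hm u huv.1.1))
  refine Finset.le_sup (f := fun q : V × V => I.dist q.1 q.2) (b := (u, v)) ?_
  simp only [Finset.mem_filter, Finset.mem_product, mem_component]
  exact ⟨⟨SimpleGraph.Reachable.refl _, hF.2 u v huv.2⟩, huv.2⟩

lemma mem_of_linked {G : Finset (Sym2 V)} {W : Finset V} (hW : W ∈ components G) {x y : V}
    (hx : x ∈ W) : y ∈ W ↔ Linked G x y := by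
  obtain ⟨v, -, rfl⟩ := mem_components.1 hW
  rw [mem_component] at *
  exact ⟨hx.symm.trans, hx.trans⟩

open Classical in
/-- The groups of all edge classes, apart from two of each class, have total width at most the
total width of `F`. -/
lemma exists_sum_width_le {A : Finset (Sym2 V)} (hF : I.Feasible F) (hT : IsTree A)
    (hAF : verts A = verts F) (hd : ∀ e ∈ A, ¬ e.IsDiag) {r : V} (hr : r ∈ verts A) :
    ∃ z : Finset (Sym2 V) → V, (∀ D, z D ∈ verts A) ∧
      ∑ D ∈ crossingSets A F, ∑ W ∈ (components (A \ edgeClass A F D ∪ F)).filter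
        (Disjoint {r, z D} ·), I.width W ≤ I.totalWidth F := by
  -- `z D` has the largest rank outside the group of `r`; its group is the second one exempt from
  -- charging. If the group of `r` is everything, `r` serves as a dummy.
  have hz : ∀ D : Finset (Sym2 V), ∃ z ∈ verts A, ∀ x ∈ verts A,
      ¬ Linked (A \ edgeClass A F D ∪ F) r x → ¬ Linked (A \ edgeClass A F D ∪ F) r z ∧
        I.widthRank F x ≤ I.widthRank F z := by
    intro D
    by_cases hne : ((verts A).filter
        fun x => ¬ Linked (A \ edgeClass A F D ∪ F) r x).Nonempty
    · obtain ⟨z, hz, hmax⟩ := Finset.exists_max_image _ (I.widthRank F) hne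
      rw [Finset.mem_filter] at hz
      exact ⟨z, hz.1, fun x hx hrx => ⟨hz.2, hmax x (Finset.mem_filter.2 ⟨hx, hrx⟩)⟩⟩
    · exact ⟨r, hr, fun x hx hrx => absurd ⟨x, Finset.mem_filter.2 ⟨hx, hrx⟩⟩ hne⟩
  choose z hzA hz using hz
  refine ⟨z, hzA, ?_⟩
  -- The group `W` will be charged to the component of `F` that contains its top-ranked vertex `m
  -- W`.
  have hm : ∀ W : Finset V, ∃ m, W.Nonempty →
      m ∈ W ∧ ∀ x ∈ W, I.widthRank F x ≤ I.widthRank F m := by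
    intro W
    by_cases hW : W.Nonempty
    · obtain ⟨m, hm⟩ := Finset.exists_max_image W (I.widthRank F) hW
      exact ⟨m, fun _ => hm⟩
    · exact ⟨r, fun h => absurd h hW⟩
  choose m hm using hm
  have hverts : ∀ D, verts (A \ edgeClass A F D ∪ F) = verts A := by
    intro D
    ext v
    simp only [hAF, SteinerForestInstance.mem_verts, Finset.mem_union, Finset.mem_sdiff]
    constructor
    · rintro ⟨e, he | he, hv⟩
      · exact SteinerForestInstance.mem_verts.1
          (hAF ▸ SteinerForestInstance.mem_verts.2 ⟨e, he.1, hv⟩)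
      · exact ⟨e, he, hv⟩
    · exact fun ⟨e, he, hv⟩ => ⟨e, Or.inr he, hv⟩
  have hmW : ∀ D, ∀ W ∈ components (A \ edgeClass A F D ∪ F), m W ∈ verts A ∧ m W ∈ W ∧
      ∀ x ∈ W, I.widthRank F x ≤ I.widthRank F (m W) := by
    intro D W hW
    obtain ⟨v, hv, rfl⟩ := mem_components.1 hW
    obtain ⟨h1, h2⟩ := hm _ ⟨v, mem_component.2 (SimpleGraph.Reachable.refl _)⟩
    exact ⟨hverts D ▸ (mem_component.1 h1).mem_verts hv, h1, h2⟩
  have hup : ∀ (D : Finset (Sym2 V)) {x y : V}, Linked F x y →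
      Linked (A \ edgeClass A F D ∪ F) x y := fun D _ _ h => h.mono Finset.subset_union_right
  -- a common charge is impossible when `r` lies in the covering group of the second class
  have half : ∀ D D' W W', W ∈ components (A \ edgeClass A F D ∪ F) →
      W' ∈ components (A \ edgeClass A F D' ∪ F) → r ∉ W → r ∉ W' → z D' ∉ W' →
      Linked F (m W) (m W') → ∀ g g', (∀ x ∈ verts A, Linked (A \ edgeClass A F D ∪ F) g x ∨
        Linked (A \ edgeClass A F D' ∪ F) g' x) →
      ¬ Linked (A \ edgeClass A F D' ∪ F) g' r := by
    intro D D' W W' hW hW' hrW hrW' hzW' hmm g g' hcov hgr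
    obtain ⟨hmA, hmW₁, hmax⟩ := hmW D W hW
    obtain ⟨hmA', hmW₁', hmax'⟩ := hmW D' W' hW'
    have hrm' : ¬ Linked (A \ edgeClass A F D' ∪ F) r (m W') := fun h =>
      hrW' ((mem_of_linked hW' hmW₁').2 h.symm)
    obtain ⟨hrz, hle⟩ := hz D' _ hmA' hrm'
    -- Both `m W'` and `z D'` are outside the `D'`-group of `r`, hence in the covering `D`-group.
    -- That group is `W`, because `F` joins `m W` to `m W'`.
    have hgm : Linked (A \ edgeClass A F D ∪ F) g (m W') :=
      (hcov _ hmA').resolve_right fun h => hrm' (hgr.symm.trans h)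
    have hgz : Linked (A \ edgeClass A F D ∪ F) g (z D') :=
      (hcov _ (hzA D')).resolve_right fun h => hrz (hgr.symm.trans h)
    have hzW : z D' ∈ W := (mem_of_linked hW hmW₁).2
      ((hup D hmm).trans (hgm.symm.trans hgz))
    -- Maximality of `m W` in `W` and of `z D'` outside the group of `r` makes the ranks equal. So
    -- `F` links `z D'` to `m W'`, and the exempt vertex would lie in `W'`.
    have hrank := le_antisymm hle ((hmax _ hzW).trans (widthRank_eq_of_linked hmm).le)
    exact hzW' ((mem_of_linked hW' hmW₁').2 (hup D' (linked_of_widthRank_eq hrank)))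
  rw [Finset.sum_sigma']
  refine (Finset.sum_le_sum (g := fun x => I.width (component F (m x.2)))
    fun x hx => ?_).trans ?_
  · obtain ⟨-, hx⟩ := Finset.mem_sigma.1 hx
    exact width_le_of_maximal hF (hmW x.1 x.2 (Finset.mem_filter.1 hx).1).2.2
  rw [← Finset.sum_image (f := I.width) (g := fun x : (_ : Finset (Sym2 V)) × Finset V =>
    component F (m x.2))]
  · refine Finset.sum_le_sum_of_subset fun K hK => ?_
    obtain ⟨x, hx, rfl⟩ := Finset.mem_image.1 hK
    obtain ⟨-, hx⟩ := Finset.mem_sigma.1 hx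
    exact mem_components.2 ⟨_, hAF ▸ (hmW x.1 x.2 (Finset.mem_filter.1 hx).1).1, rfl⟩
  · rintro ⟨D, W⟩ hx ⟨D', W'⟩ hx' heq
    have hx := Finset.mem_sigma.1 hx
    have hx' := Finset.mem_sigma.1 hx'
    simp only [Finset.mem_filter, Finset.disjoint_insert_left, Finset.disjoint_singleton_left]
      at hx hx'
    obtain ⟨hD, hW, hrW, hzW⟩ := hx
    obtain ⟨hD', hW', hrW', hzW'⟩ := hx'
    have hmm : Linked F (m W) (m W') := component_eq.1 heq
    by_cases hDD : D = D'
    · subst hDD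
      have hWW : W = W' := by
        ext x
        rw [mem_of_linked hW (hmW D W hW).2.1, mem_of_linked hW' (hmW D W' hW').2.1]
        exact ⟨(hup D hmm).symm.trans, (hup D hmm).trans⟩
      rw [hWW]
    · obtain ⟨g, g', hcov⟩ := exists_cover hT hAF hd hD hD' hDD
      rcases hcov r hr with h | h
      · exact absurd h (half D' D W' W hW' hW hrW' hrW hzW hmm.symm g' g
          fun x hx => (hcov x hx).symm)
      · exact absurd h (half D D' W W' hW hW' hrW hrW' hzW' hmm g g' hcov)

end Charging

/-! ### Summing over the classes -/

lemma length_edgeClass_le {I : SteinerForestInstance V} {A F D : Finset (Sym2 V)}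
    (hA : I.Feasible A) (hF : I.Feasible F) (hAF : verts A = verts F) (hT : IsTree A)
    (hOpt : I.EdgeSetSwapOptimal A F) (hD : D ∈ crossingSets A F) {f : Sym2 V} (hf : f ∈ D)
    {r z : V} (hr : r ∈ verts A) (hz : z ∈ verts A) :
    I.length (edgeClass A F D) ≤ 3 * I.cost f +
      ∑ W ∈ open Classical in (components (A \ edgeClass A F D ∪ F)).filter
        (Disjoint {r, z} ·), I.width W := by
  classical
  induction f using Sym2.ind with
  | _ p q =>
  have hd : ∀ e ∈ A, ¬ e.IsDiag := fun e he => I.graph.not_isDiag_of_mem_edgeSet (hA.1 he)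
  have h := cutClass_edgeClass hT hAF hd hD hf
  by_cases hfA : s(p, q) ∈ A
  · have hsub : edgeClass A F D ⊆ {s(p, q)} := by
      intro e he
      rw [Finset.mem_singleton]
      by_contra hne
      exact h.not_linked e he (linked_of_mem (Finset.mem_erase.2 ⟨fun h' => hne h'.symm, hfA⟩))
    refine le_trans (Finset.sum_le_sum_of_subset hsub) ?_
    rw [Finset.sum_singleton]
    refine le_trans ?_ le_self_add
    exact le_mul_of_one_le_left zero_le (by norm_num)
  · have h1 := h.length_le_of_finset hA hF hOpt hfA (Z := {r, z})
      (Finset.insert_subset hr (Finset.singleton_subset_iff.2 hz))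
    refine h1.trans ?_
    have hcard : ((Finset.card {r, z} : ℕ) : ℝ≥0) ≤ 2 := by exact_mod_cast Finset.card_le_two
    have h3 : ((Finset.card {r, z} : ℕ) : ℝ≥0) + 1 ≤ 3 :=
      (add_le_add_left hcard 1).trans (by norm_num)
    gcongr

lemma length_le_of_optimal {I : SteinerForestInstance V} {A F : Finset (Sym2 V)}
    (hA : I.Feasible A) (hF : I.Feasible F) (hAF : verts A = verts F) (hT : IsTree A)
    (hOpt : I.EdgeSetSwapOptimal A F) :
    I.length A ≤ 9 * I.length F + I.totalWidth F + I.length (unsafeEdges A F) := by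
  classical
  rcases A.eq_empty_or_nonempty with hA0 | ⟨e₀, he₀⟩
  · rw [hA0]
    simp [length]
  have hd : ∀ e ∈ A, ¬ e.IsDiag := fun e he => I.graph.not_isDiag_of_mem_edgeSet (hA.1 he)
  obtain ⟨r, hr⟩ : ∃ r, r ∈ verts A := by
    induction e₀ using Sym2.ind with
    | _ a b => exact ⟨a, (mem_verts_of_mem he₀).1⟩
  obtain ⟨z, hzA, hz⟩ := exists_sum_width_le hF hT hAF hd hr
  obtain ⟨g, hg, hgD⟩ := hT.exists_assignment hAF hr
  have hsafe : I.length (A.filter fun e => IsSafe A F e) ≤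
      ∑ D ∈ crossingSets A F, I.length (edgeClass A F D) := by
    unfold length
    rw [← Finset.sum_biUnion]
    · refine Finset.sum_le_sum_of_subset fun e he => ?_
      rw [Finset.mem_filter] at he
      exact Finset.mem_biUnion.2 ⟨crossing A F e, mem_crossingSets.2
        ⟨crossing_nonempty_of_isSafe he.2, e, he.1, rfl⟩, mem_edgeClass.2 ⟨he.1, rfl⟩⟩
    · intro D _ D' _ hne
      refine Finset.disjoint_left.2 fun e he he' => hne ?_
      exact (mem_edgeClass.1 he).2.symm.trans (mem_edgeClass.1 he').2
  have hcost : ∑ D ∈ (crossingSets A F).attach, I.cost (g D).1 ≤ 3 * I.length F := by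
    calc ∑ D ∈ (crossingSets A F).attach, I.cost (g D).1
        = ∑ x ∈ (crossingSets A F).attach.image g, I.cost x.1 :=
          (Finset.sum_image (f := fun x : Sym2 V × Fin 3 => I.cost x.1)
            fun D _ D' _ h => hg h).symm
      _ ≤ ∑ x ∈ F ×ˢ (Finset.univ : Finset (Fin 3)), I.cost x.1 := by
          refine Finset.sum_le_sum_of_subset fun x hx => ?_
          obtain ⟨D, -, rfl⟩ := Finset.mem_image.1 hx
          exact Finset.mem_product.2
            ⟨subset_of_mem_crossingSets D.2 (hgD D), Finset.mem_univ _⟩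
      _ = 3 * I.length F := by
          rw [Finset.sum_product]
          simp [length, Finset.mul_sum]
  have hclasses : ∑ D ∈ crossingSets A F, I.length (edgeClass A F D) ≤
      9 * I.length F + I.totalWidth F := by
    rw [← Finset.sum_attach]
    calc ∑ D ∈ (crossingSets A F).attach, I.length (edgeClass A F D.1)
        ≤ ∑ D ∈ (crossingSets A F).attach, (3 * I.cost (g D).1 +
            ∑ W ∈ (components (A \ edgeClass A F D.1 ∪ F)).filter
              (Disjoint {r, z D.1} ·), I.width W) := Finset.sum_le_sum fun D _ =>
          length_edgeClass_le hA hF hAF hT hOpt D.2 (hgD D) hr (hzA D.1)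
      _ ≤ 3 * (3 * I.length F) + I.totalWidth F := by
          rw [Finset.sum_add_distrib, ← Finset.mul_sum]
          refine add_le_add (by gcongr) (le_trans (le_of_eq ?_) hz)
          exact Finset.sum_attach (crossingSets A F) fun D =>
            ∑ W ∈ (components (A \ edgeClass A F D ∪ F)).filter
              (Disjoint {r, z D} ·), I.width W
      _ = 9 * I.length F + I.totalWidth F := by ring
  have hsplit : I.length A = I.length (A.filter fun e => IsSafe A F e) +
      I.length (unsafeEdges A F) :=
    (Finset.sum_filter_add_sum_filter_not A (IsSafe A F) I.cost).symm
  rw [hsplit]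
  exact add_le_add_left (hsafe.trans hclasses) _

end SteinerForestInstance

theorem mainTheorem5 {V : Type*} [Fintype V] [DecidableEq V] (I : SteinerForestInstance V)
    (A F : Finset (Sym2 V)) (hA : I.Feasible A) (hF : I.Feasible F)
    (hAF : SteinerForestInstance.verts A = SteinerForestInstance.verts F)
    (hTree : SteinerForestInstance.IsTree A) (hOpt : I.EdgeSetSwapOptimal A F) :
    I.potential A ≤ 10.5 * I.length F + I.totalWidth F +
        I.length (SteinerForestInstance.unsafeEdges A F) + I.totalWidth A ∧
      I.length A ≤ 10.5 * I.length F + I.totalWidth F +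
        I.length (SteinerForestInstance.unsafeEdges A F) := by
  have h : I.length A ≤ 10.5 * I.length F + I.totalWidth F +
      I.length (SteinerForestInstance.unsafeEdges A F) := by
    refine (SteinerForestInstance.length_le_of_optimal hA hF hAF hTree hOpt).trans ?_
    gcongr
    norm_num
    rw [le_div_iff₀ (by norm_num)]
    norm_num
  exact ⟨add_le_add_left h _, h⟩
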